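/- **Setting.** Let $f\in\mathbb R[\mathbf x]=\mathbb R[x_1,\dots,x_n]$ and let $\mathbf g=(\mathbf g^0,\mathbf g^+)$ be finite sets of polynomials. For a set of constraints $G=(G^0,G^+)$ let $\mathcal S(G)=\{x\in\mathbb R^n: g(x)=0\ \forall g\in G^0,\ g(x)\ge 0\ \forall g\in G^+\}$. Assume that $S=\mathcal S(\mathbf g)$ is non-empty and that $f$ is bounded below on $S$. Put $f^*=\inf_S f$, $V_{min}=\{x\in S: f(x)=f^*\}$, let $I_{min}\subset\mathbb R[\mathbf x]$ be the vanishing ideal of $V_{min}$, $A_{min}=\mathbb R[\mathbf x]/I_{min}$, and let $M_k:A_{min}\to A_{min}$ be the multiplication by $x_k$, $k=1,\dots,n$. For a vector subspace $V\subset\mathbb R[\mathbf x]$ let $V^+=V+x_1V+\dots+x_nV$, and let $\langle V\cdot V\rangle$ be the span of the products of two elements of $V$. $V$ is *connected to $1$* if there are vector spaces $\langle 1\rangle=V_0\subset V_1\subset\dots\subset V_N=V$ with $V_{i+1}\subset V_i^+$. Let $E\subset\mathbb R[\mathbf x]$ be a finite-dimensional vector space connected to $1$, and $G$ a set of constraints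 with $V_{min}\subset\mathcal S(G)\subset S$ and $\inf_{\mathcal S(G)}f=f^*$ (for instance $\mathcal S(G)=S$). Let $\mathcal Q_{E,G}$ be the set of finite sums $\sum_{g\in G^0}g\,h_g+\sum_{g\in G^+\cup\{1\}}g\,\sigma_g$ with $h_g\in E$, $\sigma_g$ a sum of squares of elements of $E$, and all the products $g\,h_g$, $g\,\sigma_g$ in $\langle E\cdot E\rangle$. Let $\mathcal L_{E,G}$ be the set of the linear forms $\Lambda$ on $\langle E\cdot E\rangle$ with $\Lambda\ge 0$ on $\mathcal Q_{E,G}$ and $\Lambda(1)=1$. For $V\subset E$ let $H^V_\Lambda:V\to V^*$, $H^V_\Lambda(p)(q)=\Lambda(pq)$. For $f\in\langle E\cdot E\rangle$, a form $\Lambda^*\in\mathcal L_{E,G}$ is *optimal for $f$* if $\Lambda^*(f)=\inf_{\Lambda\in\mathcal L_{E,G}}\Lambda(f)$ and $\operatorname{rank}H^E_{\Lambda^*}$ is maximal among all $\Lambda\in\mathcal L_{E,G}$ that attain this infimum. The *Decomposition algorithm* on $(E,\Lambda^*)$, with $\langle p,q\rangle_*=\Lambda^*(pq)$, starts with $B=\{1\}$,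 $s=1$. While $s>0$ and $\langle B\rangle^+\subset E$, it computes, with $B=\{b_1,\dots,b_r\}$, the polynomials $b_{j,k}=x_kb_j-\sum_{i=1}^r\frac{\langle x_kb_j,b_i\rangle_*}{\langle b_i,b_i\rangle_*}b_i$, chooses a maximal family $B'$ of pairwise orthogonal elements of the span of the $b_{j,k}$ with $\langle b',b'\rangle_*\ne0$ for $b'\in B'$, and sets $B:=B\cup B'$, $s:=|B'|$. It stops with *success* and returns $B$ if the loop is left with $s=0$ and $\langle B\rangle^+\subset E$. **Proposition.** Let $\Lambda^*\in\mathcal L_{E,G}$ be optimal for $f$ and suppose that the Decomposition algorithm on $(E,\Lambda^*)$ stops with success and returns $B=\{b_1,\dots,b_r\}$. Suppose that the flat extension property holds on a space large enough for the data: there is a vector space $W$ connected to $1$ with $\langle B\rangle^+\subset W\subset E$ (for instance $W=E$) such that $\operatorname{rank}H^W_{\Lambda^*}=\operatorname{rank}H^{\langle B\rangle}_{\Lambda^*}$, $f\in\langle W\cdot W\rangle$, $G^0\cdot\langle B\rangle\subset\langle W\cdot W\rangle$ and $G^+\cdot\langle B\rangle\cdot\langle B\rangle\subset\langle W\cdot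 W\rangle$. Then: 1. $\Lambda^*(b_ib_i)\neq0$ for all $i$, the classes of $b_1,\dots,b_r$ form a basis of $A_{min}$, and for $k=1,\dots,n$ the matrix of $M_k$ in this basis is $$[M_k]=\left(\frac{\Lambda^*(x_k\,b_i\,b_j)}{\Lambda^*(b_i\,b_i)}\right)_{1\le i,j\le r}.$$ 2. $f$ has exactly $r$ minimizer points on $S$, $V_{min}=\{\xi_1,\dots,\xi_r\}$ with $\xi_i=(\xi_{i,1},\dots,\xi_{i,n})\in S$, and the operators $M_1,\dots,M_n$ have $r$ linearly independent common eigenvectors $u_1,\dots,u_r\in A_{min}$ with $M_ku_i=\xi_{i,k}u_i$ for all $i,k$. -/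

import Mathlib

noncomputable section

namespace PolyOpt

/-- The polynomial ring `ℝ[x₁, …, xₙ]`. -/
abbrev Poly (n : ℕ) : Type := MvPolynomial (Fin n) ℝ

/-- A set of constraints `G`: equality constraints `G⁰` and non-negativity constraints `G⁺`. -/
structure Constraints (n : ℕ) where
  eqs : Set (Poly n)
  nonnegs : Set (Poly n)

/-- The basic semi-algebraic set `𝒮(G)`. -/
def Constraints.feasible {n : ℕ} (G : Constraints n) : Set (Fin n → ℝ) :=
  {x | (∀ g ∈ G.eqs, MvPolynomial.eval x g = 0) ∧ ∀ g ∈ G.nonnegs, 0 ≤ MvPolynomial.eval x g}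

/-- The infimum of `f` on `S` (used for `S` non-empty and `f` bounded below on `S`). -/
def infValue {n : ℕ} (f : Poly n) (S : Set (Fin n → ℝ)) : ℝ :=
  sInf ((fun x => MvPolynomial.eval x f) '' S)

/-- The set `V_min` of minimizer points of `f` on `S`. -/
def minimizers {n : ℕ} (f : Poly n) (S : Set (Fin n → ℝ)) : Set (Fin n → ℝ) :=
  {x | x ∈ S ∧ MvPolynomial.eval x f = infValue f S}

/-- The minimizer ideal `I_min`, the vanishing ideal of `V_min`. -/
def minIdeal {n : ℕ} (f : Poly n) (S : Set (Fin n → ℝ)) : Ideal (Poly n) :=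
  MvPolynomial.vanishingIdeal ℝ (minimizers f S)

/-- The quotient algebra `A_min = ℝ[x] / I_min`. -/
abbrev MinAlgebra {n : ℕ} (f : Poly n) (S : Set (Fin n → ℝ)) : Type :=
  Poly n ⧸ minIdeal f S

/-- The operator `M_k : a ↦ x_k a` on `A_min`. -/
def mulOp {n : ℕ} (f : Poly n) (S : Set (Fin n → ℝ)) (k : Fin n) :
    MinAlgebra f S →ₗ[ℝ] MinAlgebra f S :=
  LinearMap.mulLeft ℝ (Ideal.Quotient.mk (minIdeal f S) (MvPolynomial.X k))

/-- The prolongation `E⁺ = E + x₁ E + ⋯ + xₙ E`. -/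
def prolong {n : ℕ} (E : Submodule ℝ (Poly n)) : Submodule ℝ (Poly n) :=
  E ⊔ ⨆ k : Fin n, E.map (LinearMap.mulLeft ℝ (MvPolynomial.X k : Poly n))

theorem le_prolong {n : ℕ} (E : Submodule ℝ (Poly n)) : E ≤ prolong E :=
  le_sup_left

/-- `E` is connected to `1`: it is the last term of a finite increasing sequence
`⟨1⟩ = E₀ ⊆ E₁ ⊆ ⋯` of vector spaces with `E_{i+1} ⊆ E_i⁺`. -/
def ConnectedToOne {n : ℕ} (E : Submodule ℝ (Poly n)) : Prop :=
  ∃ c : ℕ → Submodule ℝ (Poly n), c 0 = Submodule.span ℝ {1} ∧ Monotone c ∧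
    (∀ i, c (i + 1) ≤ prolong (c i)) ∧ ∃ N, c N = E

/-- The set `Σ²(E)` of finite sums of squares of elements of `E`. -/
def sumSquares {n : ℕ} (E : Submodule ℝ (Poly n)) : AddSubmonoid (Poly n) :=
  AddSubmonoid.closure {p | ∃ e ∈ E, p = e ^ 2}

/-- The truncated quadratic module `𝒬_{E,G}`. The product of submodules `E * E` is the span
`⟨E · E⟩` of the products of two elements of `E`. The constraint `1 ≥ 0` always belongs to the
non-negativity constraints, so that the sums of squares themselves are in `𝒬_{E,G}`. -/
def quadModule {n : ℕ} (E : Submodule ℝ (Poly n)) (G : Constraints n) : Set (Poly n) :=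
  {p | ∃ (s t : Finset (Poly n)) (h σ : Poly n → Poly n),
    (↑s ⊆ G.eqs) ∧ (↑t ⊆ insert 1 G.nonnegs) ∧
    (∀ g ∈ s, h g ∈ E ∧ g * h g ∈ E * E) ∧
    (∀ g ∈ t, σ g ∈ sumSquares E ∧ g * σ g ∈ E * E) ∧
    p = ∑ g ∈ s, g * h g + ∑ g ∈ t, g * σ g}

open Classical in
/-- The value `Λ(p)` of a linear form `Λ` on `W` at a polynomial `p` of `W` (it is only used for
`p ∈ W`; the value elsewhere is `0`). -/
def formAt {n : ℕ} {W : Submodule ℝ (Poly n)} (Λ : Module.Dual ℝ W) (p : Poly n) : ℝ :=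
  if h : p ∈ W then Λ ⟨p, h⟩ else 0

/-- The convex set `ℒ_{E,G}` of linear forms on `⟨E · E⟩`. -/
def dualCone {n : ℕ} (E : Submodule ℝ (Poly n)) (G : Constraints n) :
    Set (Module.Dual ℝ ↥(E * E)) :=
  {Λ | (∀ p ∈ quadModule E G, 0 ≤ formAt Λ p) ∧ formAt Λ 1 = 1}

/-- The truncated Hankel operator `H_Λ^E : E → E^*`, `H_Λ^E(p)(q) = Λ(p q)`. -/
def hankel {n : ℕ} (E : Submodule ℝ (Poly n)) (Λ : Module.Dual ℝ ↥(E * E)) :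
    E →ₗ[ℝ] Module.Dual ℝ E :=
  LinearMap.mk₂ ℝ (fun p q => Λ ⟨(p : Poly n) * q, Submodule.mul_mem_mul p.2 q.2⟩)
    (fun p p' q => by rw [← map_add]; congr 1; ext1; simp [add_mul])
    (fun c p q => by rw [← map_smul]; congr 1; ext1; simp)
    (fun p q q' => by rw [← map_add]; congr 1; ext1; simp [mul_add])
    (fun c p q => by rw [← map_smul]; congr 1; ext1; simp)

/-- The rank of `H_Λ^E`. -/
def hankelRank {n : ℕ} (E : Submodule ℝ (Poly n)) (Λ : Module.Dual ℝ ↥(E * E)) : ℕ :=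
  Module.finrank ℝ (LinearMap.range (hankel E Λ))

/-- The restriction to `⟨V · V⟩` of a linear form on `⟨E · E⟩`, for `V ⊆ E`. -/
def restrictForm {n : ℕ} {V E : Submodule ℝ (Poly n)} (h : V ≤ E)
    (Λ : Module.Dual ℝ ↥(E * E)) : Module.Dual ℝ ↥(V * V) :=
  Λ.comp (Submodule.inclusion (mul_le_mul' h h))

/-- For `V ⊆ E`: `H_Λ^E` is a flat extension of `H_Λ^V`, i.e. both have the same rank. -/
def IsFlatExtension {n : ℕ} {V E : Submodule ℝ (Poly n)} (h : V ≤ E)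
    (Λ : Module.Dual ℝ ↥(E * E)) : Prop :=
  hankelRank E Λ = hankelRank V (restrictForm h Λ)

/-- The relaxed infimum `f^μ_{E,G} = inf {Λ(f) : Λ ∈ ℒ_{E,G}}` for `f ∈ ⟨E · E⟩`, equal to `+∞`
if `ℒ_{E,G}` is empty. -/
def relaxedInf {n : ℕ} (f : Poly n) (E : Submodule ℝ (Poly n)) (G : Constraints n) : EReal :=
  ⨅ Λ ∈ dualCone E G, ((formAt Λ f : ℝ) : EReal)

/-- `Λ` is optimal for `f`: it belongs to `ℒ_{E,G}`, attains `f^μ_{E,G}`, and its truncated Hankel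
operator has the largest rank among all such linear forms. -/
def IsOptimalForm {n : ℕ} (f : Poly n) (E : Submodule ℝ (Poly n)) (G : Constraints n)
    (Λ : Module.Dual ℝ ↥(E * E)) : Prop :=
  Λ ∈ dualCone E G ∧ ((formAt Λ f : ℝ) : EReal) = relaxedInf f E G ∧
    ∀ Λ' ∈ dualCone E G, ((formAt Λ' f : ℝ) : EReal) = relaxedInf f E G →
      hankelRank E Λ' ≤ hankelRank E Λ

/-- The linear span of the elements of a list. -/
def spanList {n : ℕ} (B : List (Poly n)) : Submodule ℝ (Poly n) :=
  Submodule.span ℝ {b | b ∈ B}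

/-- `x_k b - ∑_i (⟨x_k b, b_i⟩_* / ⟨b_i, b_i⟩_*) b_i`, the sum over the members `b_i` of the list
`B`, with `⟨p, q⟩_* = Λ(p q)`. -/
def decompResidual {n : ℕ} {E : Submodule ℝ (Poly n)} (Λ : Module.Dual ℝ ↥(E * E))
    (B : List (Poly n)) (b : Poly n) (k : Fin n) : Poly n :=
  MvPolynomial.X k * b -
    (B.map fun c => (formAt Λ (MvPolynomial.X k * b * c) / formAt Λ (c * c)) • c).sum

/-- The span of all `b_{j,k}`. -/
def residualSpan {n : ℕ} {E : Submodule ℝ (Poly n)} (Λ : Module.Dual ℝ ↥(E * E))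
    (B : List (Poly n)) : Submodule ℝ (Poly n) :=
  Submodule.span ℝ {p | ∃ b ∈ B, ∃ k : Fin n, p = decompResidual Λ B b k}

/-- `B'` is a maximal family of pairwise orthogonal, non-isotropic vectors of `L` for the inner
product `⟨p, q⟩_* = Λ(p q)`. -/
def IsMaximalOrthogonal {n : ℕ} {E : Submodule ℝ (Poly n)} (Λ : Module.Dual ℝ ↥(E * E))
    (L : Submodule ℝ (Poly n)) (B' : List (Poly n)) : Prop :=
  (∀ b ∈ B', b ∈ L ∧ formAt Λ (b * b) ≠ 0) ∧
  B'.Pairwise (fun b c => formAt Λ (b * c) = 0) ∧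
  ∀ p ∈ L, (∀ b ∈ B', formAt Λ (p * b) = 0) → formAt Λ (p * p) = 0

/-- The states `(B, s)` that a run of the Decomposition algorithm on `(E, Λ)` can reach at the
head of its loop: it starts with `B = {1}`, `s = 1`, and while `s > 0` and `B⁺ ⊆ E` it chooses a
maximal orthogonal family `B'` in the span of the `b_{j,k}`, appends it to `B` and sets
`s = |B'|`. -/
inductive DecompState {n : ℕ} (E : Submodule ℝ (Poly n)) (Λ : Module.Dual ℝ ↥(E * E)) :
    List (Poly n) → ℕ → Prop
  | init : DecompState E Λ [1] 1
  | step {B : List (Poly n)} {s : ℕ} {B' : List (Poly n)} :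
      DecompState E Λ B s → 0 < s → prolong (spanList B) ≤ E →
      IsMaximalOrthogonal Λ (residualSpan Λ B) B' →
      DecompState E Λ (B ++ B') B'.length

/-- A run of the Decomposition algorithm on `(E, Λ)` stops with `success` and returns `B`: the
loop is left with `s = 0` and `B⁺ ⊆ E`. -/
def DecompositionSucceeds {n : ℕ} (E : Submodule ℝ (Poly n)) (Λ : Module.Dual ℝ ↥(E * E))
    (B : List (Poly n)) : Prop :=
  DecompState E Λ B 0 ∧ prolong (spanList B) ≤ E

end PolyOpt

end

noncomputable section

namespace PolyOpt

open MvPolynomial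

/-! Flatness makes `Λ` on $\langle W\cdot W\rangle$ a Euclidean inner product in the coordinates of
the normalized family $B$. Multiplication by $x_k$, compressed to $\langle B\rangle$, is then a
symmetric operator, and these operators commute because $\langle B\rangle^+\subset W$. Splitting the
vector of $1$ into joint eigenvectors gives a quadrature $\Lambda(p)=\sum_i w_i\,p(\xi_i)$ with
exactly $r$ nodes and $w_i>0$ (`exists_quadrature`).

The products required to lie in $\langle W\cdot W\rangle$ let Lagrange interpolants in $\langle
B\rangle$ test the constraints, so the nodes are feasible. Since the relaxation is a lower bound,
$\Lambda(f)\le f^*$, while $\Lambda(f)$ is a convex combination of values $f(\xi_i)\ge f^*$. So all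
nodes are minimizers.

Conversely, rank maximality makes the kernel of the Hankel operator vanish on $V_{min}$
(`IsOptimalForm.eval_eq_zero`), and kernel elements built from the interpolants exclude any further
minimizer. Thus $A_{min}$ is the algebra of functions on the $r$ nodes: $B$ is an orthogonal basis,
the interpolants are the eigenvectors. -/

/-- A vector is a finite sum of pairwise orthogonal joint eigenvectors of a commuting family of
symmetric operators. -/
theorem exists_sum_jointEigenvectors {V : Type*} [NormedAddCommGroup V] [InnerProductSpace ℝ V]
    [FiniteDimensional ℝ V] {ι : Type*} (T : ι → V →ₗ[ℝ] V)
    (hT : ∀ i, (T i).IsSymmetric) (hC : ∀ i j, Commute (T i) (T j)) (v₀ : V) :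
    ∃ (F : Finset (ι → ℝ)) (v : (ι → ℝ) → V), (∀ χ ∈ F, v χ ≠ 0) ∧
      (∀ χ k, T k (v χ) = χ k • v χ) ∧
      (∀ χ ψ, χ ≠ ψ → inner ℝ (v χ) (v ψ) = 0) ∧ ∑ χ ∈ F, v χ = v₀ := by
  have htop := LinearMap.IsSymmetric.iSup_iInf_eq_top_of_commute hT fun i j _ => hC i j
  obtain ⟨v, hv, hsum⟩ := (Submodule.mem_iSup_iff_exists_finsupp _ v₀).mp
    (htop.symm ▸ Submodule.mem_top)
  refine ⟨v.support, v, fun χ hχ => by simpa using hχ, fun χ k => ?_, fun χ ψ hne => ?_, hsum⟩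
  · exact Module.End.mem_eigenspace_iff.mp ((Submodule.mem_iInf _).mp (hv χ) k)
  · exact LinearMap.IsSymmetric.orthogonalFamily_iInf_eigenspaces hT hne ⟨v χ, hv χ⟩ ⟨v ψ, hv ψ⟩

/-! ### Prolongations and the flat extension theorem -/

theorem mul_X_mem_prolong {n : ℕ} {V : Submodule ℝ (Poly n)} {p : Poly n} (hp : p ∈ V)
    (k : Fin n) : X k * p ∈ prolong V :=
  (le_sup_right : _ ≤ prolong V)
    (Submodule.mem_iSup_of_mem k (Submodule.mem_map_of_mem (f := LinearMap.mulLeft ℝ (X k)) hp))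

/-- Elements of the prolongation are of the form `q₀ + ∑ x_k q_k`. -/
theorem exists_of_mem_prolong {n : ℕ} {V : Submodule ℝ (Poly n)} {p : Poly n}
    (hp : p ∈ prolong V) :
    ∃ q₀ ∈ V, ∃ q : Fin n → Poly n, (∀ k, q k ∈ V) ∧ p = q₀ + ∑ k, X k * q k := by
  obtain ⟨q₀, hq₀, s, hs, rfl⟩ := Submodule.mem_sup.mp hp
  obtain ⟨μ, hμ⟩ := (Submodule.mem_iSup_finset_iff_exists_sum (s := Finset.univ) _ s).mp
    (by simpa using hs)
  have hμ' : ∀ k, ∃ q ∈ V, X k * q = (μ k : Poly n) := fun k => (μ k).2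
  choose q hq hqμ using hμ'
  exact ⟨q₀, hq₀, q, hq, by simp [hqμ, hμ]⟩

theorem ConnectedToOne.one_mem {n : ℕ} {V : Submodule ℝ (Poly n)} (hV : ConnectedToOne V) :
    (1 : Poly n) ∈ V := by
  obtain ⟨c, h0, hmono, -, N, rfl⟩ := hV
  exact hmono (Nat.zero_le N) (h0 ▸ Submodule.mem_span_singleton_self 1)

/-- Flat extension theorem: if `L` is, on `⟨W · W⟩`, the standard inner product of the coordinates
with respect to an orthonormal family `β` with `⟨β⟩⁺ ⊆ W`, then `L` is on `⟨W · W⟩` a positive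
combination of evaluations at as many points as `β` has members. -/
theorem exists_quadrature {n r : ℕ} (L : Poly n →ₗ[ℝ] ℝ) (W : Submodule ℝ (Poly n))
    (hW : ConnectedToOne W) (β : Fin r → Poly n)
    (hβW : prolong (Submodule.span ℝ (Set.range β)) ≤ W)
    (hβ : ∀ i j, L (β i * β j) = if i = j then 1 else 0)
    (hflat : ∀ p ∈ W, ∀ q ∈ W, L (p * q) = ∑ i, L (p * β i) * L (q * β i)) :
    ∃ (ξ : Fin r → Fin n → ℝ) (w : Fin r → ℝ), Function.Injective ξ ∧ (∀ i, 0 < w i) ∧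
      ∀ p ∈ W * W, L p = ∑ i, w i * eval (ξ i) p := by
  let T : EuclideanSpace ℝ (Fin r) →ₗ[ℝ] Poly n :=
    (Fintype.linearCombination ℝ β).comp (WithLp.linearEquiv 2 ℝ (Fin r → ℝ)).toLinearMap
  have hT : ∀ v : EuclideanSpace ℝ (Fin r), T v = ∑ i, v i • β i := fun v => by
    simp [T, Fintype.linearCombination_apply]
  have hTB : ∀ v : EuclideanSpace ℝ (Fin r), T v ∈ Submodule.span ℝ (Set.range β) := fun v => by
    rw [hT]
    exact Submodule.sum_mem _ fun i _ => Submodule.smul_mem _ _ (Submodule.subset_span ⟨i, rfl⟩)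
  have hBW : ∀ p ∈ Submodule.span ℝ (Set.range β), p ∈ W := fun p hp =>
    hβW (le_prolong _ hp)
  have hXW : ∀ (v : EuclideanSpace ℝ (Fin r)) k, X k * T v ∈ W := fun v k => hβW (mul_X_mem_prolong (hTB v) k)
  have hTW : ∀ v : EuclideanSpace ℝ (Fin r), T v ∈ W := fun v => hBW _ (hTB v)
  -- Coordinates of the orthogonal projection onto $\langle\beta\rangle$; flatness says that on $W$
  -- they lose nothing of the form.
  let c : Poly n →ₗ[ℝ] EuclideanSpace ℝ (Fin r) := (WithLp.linearEquiv 2 ℝ (Fin r → ℝ)).symm.toLinearMap.comp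
    (LinearMap.pi fun i => L.comp (LinearMap.mulRight ℝ (β i)))
  have hc : ∀ p i, c p i = L (p * β i) := fun p i => by simp [c]
  have hinner : ∀ p ∈ W, ∀ q ∈ W, inner ℝ (c p) (c q) = L (p * q) := fun p hp q hq => by
    rw [hflat p hp q hq, PiLp.inner_apply]
    simp [hc, mul_comm]
  have hcT : ∀ v : EuclideanSpace ℝ (Fin r), c (T v) = v := fun v => by
    ext i
    rw [hc, hT, Finset.sum_mul, map_sum]
    simp [hβ]
  have hinner' : ∀ (p : Poly n) (v : EuclideanSpace ℝ (Fin r)), inner ℝ (c p) v = L (p * T v) := fun p v => by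
    rw [PiLp.inner_apply, hT, Finset.mul_sum, map_sum]
    simp [hc]
  let M : Fin n → EuclideanSpace ℝ (Fin r) →ₗ[ℝ] EuclideanSpace ℝ (Fin r) := fun k => (c.comp (LinearMap.mulLeft ℝ (X k))).comp T
  have hM : ∀ k v, M k v = c (X k * T v) := fun k v => rfl
  have hMi : ∀ k p v, p ∈ W → inner ℝ (M k (c p)) v = L (p * (X k * T v)) := fun k p v hp => by
    rw [hM, hinner']
    have : X k * T (c p) * T v = T (c p) * (X k * T v) := by ring
    rw [this, ← hinner _ (hTW _) _ (hXW _ _), hcT, hinner _ hp _ (hXW _ _)]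
  have hsymm : ∀ k, (M k).IsSymmetric := fun k v w => by
    rw [hM, hinner', real_inner_comm, hM, hinner']
    congr 1; ring
  -- Both composites pair with $w$ to $L(x_kx_l\,Tv\,Tw)$: one variable goes to each factor, so both
  -- factors stay in $W$.
  have hcomm : ∀ k l, Commute (M k) (M l) := fun k l => by
    refine LinearMap.ext fun v => ext_inner_right ℝ fun w => ?_
    rw [Module.End.mul_apply, Module.End.mul_apply, hM l v, hM k v, hMi _ _ _ (hXW _ _),
      hMi _ _ _ (hXW _ _)]
    congr 1; ring
  obtain ⟨F, v, hv0, hvM, hvo, hvs⟩ := exists_sum_jointEigenvectors M hsymm hcomm (c 1)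
  -- This is $p(M)$ applied to the coordinates of $1$. Connectedness to $1$ lets $c(p)=p(M)\,c(1)$
  -- propagate along the chain up to $W$.
  let φ : Poly n → EuclideanSpace ℝ (Fin r) := fun p => ∑ χ ∈ F, eval χ p • v χ
  have hφc : ∀ p ∈ W, c p = φ p := by
    obtain ⟨d, hd0, hdm, hds, N, rfl⟩ := hW
    have key : ∀ i, i ≤ N → ∀ p ∈ d i, c p = φ p := by
      intro i
      induction i with
      | zero =>
        intro _ p hp
        rw [hd0] at hp
        obtain ⟨a, rfl⟩ := Submodule.mem_span_singleton.mp hp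
        simp only [φ, map_smul, ← hvs, Finset.smul_sum, map_one, smul_eval, mul_one]
      | succ i ih =>
        intro hi p hp
        obtain ⟨q₀, hq₀, q, hq, rfl⟩ := exists_of_mem_prolong (hds i hp)
        have hqN : ∀ k, q k ∈ d N := fun k => hdm (by omega) (hq k)
        have h1 : c (q₀ + ∑ k, X k * q k) = c q₀ + ∑ k, M k (c (q k)) := by
          refine ext_inner_right ℝ fun w => ?_
          rw [map_add, map_sum, inner_add_left, inner_add_left, sum_inner, sum_inner]
          congr 1
          refine Finset.sum_congr rfl fun k _ => ?_
          rw [hMi _ _ _ (hqN k), hinner']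
          congr 1; ring
        rw [h1, ih (by omega) _ hq₀]
        simp_rw [fun k => ih (by omega) _ (hq k)]
        simp only [φ, map_sum, map_smul, hvM, map_add, map_mul, eval_X, add_smul,
          Finset.sum_add_distrib, Finset.sum_smul]
        congr 1
        rw [Finset.sum_comm]
        refine Finset.sum_congr rfl fun χ _ => Finset.sum_congr rfl fun k _ => ?_
        rw [smul_smul, mul_comm]
    exact key N le_rfl
  have hquad : ∀ p ∈ W * W, L p = ∑ χ ∈ F, ‖v χ‖ ^ 2 * eval χ p := by
    intro p hp
    induction hp using Submodule.mul_induction_on' with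
    | mem_mul_mem p hp q hq =>
      rw [← hinner p hp q hq, hφc p hp, hφc q hq]
      simp only [φ, sum_inner, inner_sum, inner_smul_left, inner_smul_right]
      refine Finset.sum_congr rfl fun χ hχ => ?_
      rw [Finset.sum_eq_single χ (fun ψ _ hne => by simp [hvo ψ χ hne])
        (fun h => absurd hχ h), real_inner_self_eq_norm_sq]
      simp; ring
    | add p _ q _ hp hq => simp [hp, hq, mul_add, Finset.sum_add_distrib]
  have hcard₁ : F.card ≤ r := by
    have hli : LinearIndependent ℝ fun χ : F => v χ :=
      linearIndependent_of_ne_zero_of_inner_eq_zero (fun χ => hv0 χ χ.2)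
        fun χ ψ hne => hvo χ ψ fun h => hne (Subtype.ext h)
    simpa using hli.fintype_card_le_finrank
  -- An element of $\langle\beta\rangle$ vanishing at all nodes has zero coordinates, so evaluation
  -- at the nodes is injective on it.
  have hcard₂ : r ≤ F.card := by
    let ev : EuclideanSpace ℝ (Fin r) →ₗ[ℝ] (F → ℝ) :=
      (LinearMap.pi fun χ : F => (aeval (χ : Fin n → ℝ)).toLinearMap).comp T
    have hinj : Function.Injective ev := by
      rw [← LinearMap.ker_eq_bot, LinearMap.ker_eq_bot']
      intro u hu
      have hz : ∀ χ ∈ F, eval χ (T u) = 0 := fun χ hχ => by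
        simpa [ev, coe_aeval_eq_eval] using congrFun hu ⟨χ, hχ⟩
      rw [← hcT u, hφc _ (hTW u)]
      exact Finset.sum_eq_zero fun χ hχ => by rw [hz χ hχ, zero_smul]
    simpa using LinearMap.finrank_le_finrank_of_injective hinj
  let e : Fin r ≃ F := (F.equivFinOfCardEq (le_antisymm hcard₁ hcard₂)).symm
  refine ⟨fun i => e i, fun i => ‖v (e i)‖ ^ 2,
    Subtype.val_injective.comp e.injective, fun i => ?_, fun p hp => ?_⟩
  · exact pow_pos (norm_pos_iff.mpr (hv0 _ (e i).2)) 2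
  · rw [hquad p hp, ← Finset.sum_coe_sort F, ← e.sum_comp]

/-! ### Positive forms, optimality and flatness -/

section Forms

variable {n : ℕ} {E : Submodule ℝ (Poly n)}

theorem formAt_of_mem (Λ : Module.Dual ℝ ↥(E * E)) {p : Poly n} (hp : p ∈ E * E) :
    formAt Λ p = Λ ⟨p, hp⟩ :=
  dif_pos hp

theorem formAt_add_form (Λ Λ' : Module.Dual ℝ ↥(E * E)) (p : Poly n) :
    formAt (Λ + Λ') p = formAt Λ p + formAt Λ' p := by
  by_cases hp : p ∈ E * E <;> simp [formAt, hp]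

theorem formAt_smul_form (a : ℝ) (Λ : Module.Dual ℝ ↥(E * E)) (p : Poly n) :
    formAt (a • Λ) p = a * formAt Λ p := by
  by_cases hp : p ∈ E * E <;> simp [formAt, hp]

/-- `formAt` is not additive outside $\langle E\cdot E\rangle$, where it defaults to $0$; a linear
extension to all polynomials allows free computation. -/
theorem exists_extend_formAt (Λ : Module.Dual ℝ ↥(E * E)) :
    ∃ L : Poly n →ₗ[ℝ] ℝ, ∀ p ∈ E * E, formAt Λ p = L p := by
  obtain ⟨L, hL⟩ := LinearMap.exists_extend Λ
  exact ⟨L, fun p hp => by rw [formAt_of_mem Λ hp, ← hL]; rfl⟩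

/-- The evaluation at `x` as a linear form on `⟨E · E⟩`. -/
def evalForm (E : Submodule ℝ (Poly n)) (x : Fin n → ℝ) : Module.Dual ℝ ↥(E * E) :=
  (aeval x).toLinearMap.comp (E * E).subtype

theorem formAt_evalForm (x : Fin n → ℝ) {p : Poly n} (hp : p ∈ E * E) :
    formAt (evalForm E x) p = eval x p := by
  rw [formAt_of_mem _ hp]
  simp [evalForm]

theorem eval_nonneg_of_mem_sumSquares (x : Fin n → ℝ) {p : Poly n} (hp : p ∈ sumSquares E) :
    0 ≤ eval x p := by
  induction hp using AddSubmonoid.closure_induction with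
  | mem p hp => obtain ⟨e, -, rfl⟩ := hp; simp only [map_pow]; positivity
  | zero => simp
  | add p q _ _ hp hq => simpa using add_nonneg hp hq

variable {G : Constraints n}

theorem mem_mul_of_mem_quadModule {p : Poly n} (hp : p ∈ quadModule E G) : p ∈ E * E := by
  obtain ⟨s, t, h, σ, -, -, hh, hσ, rfl⟩ := hp
  exact add_mem (sum_mem fun g hg => (hh g hg).2) (sum_mem fun g hg => (hσ g hg).2)

/-- This is why the relaxation is a lower bound: evaluations at feasible points compete in it. -/
theorem evalForm_mem_dualCone (h1 : (1 : Poly n) ∈ E) {x : Fin n → ℝ} (hx : x ∈ G.feasible) :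
    evalForm E x ∈ dualCone E G := by
  refine ⟨fun p hp => ?_, ?_⟩
  · rw [formAt_evalForm x (mem_mul_of_mem_quadModule hp)]
    obtain ⟨s, t, h, σ, hs, ht, hh, hσ, rfl⟩ := hp
    rw [map_add, map_sum, map_sum]
    refine add_nonneg (le_of_eq (Finset.sum_eq_zero fun g hg => ?_).symm)
      (Finset.sum_nonneg fun g hg => ?_)
    · rw [map_mul, hx.1 g (hs hg), zero_mul]
    · rw [map_mul]
      refine mul_nonneg ?_ (eval_nonneg_of_mem_sumSquares x (hσ g hg).1)
      rcases ht hg with rfl | hg'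
      · simp
      · exact hx.2 g hg'
  · rw [formAt_evalForm x (by simpa using Submodule.mul_mem_mul h1 h1)]
    simp

theorem midpoint_mem_dualCone {Λ Λ' : Module.Dual ℝ ↥(E * E)} (hΛ : Λ ∈ dualCone E G)
    (hΛ' : Λ' ∈ dualCone E G) : (1 / 2 : ℝ) • (Λ + Λ') ∈ dualCone E G := by
  refine ⟨fun p hp => ?_, ?_⟩
  · rw [formAt_smul_form, formAt_add_form]
    have := hΛ.1 p hp
    have := hΛ'.1 p hp
    positivity
  · rw [formAt_smul_form, formAt_add_form, hΛ.2, hΛ'.2]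
    norm_num

theorem mul_self_mem_sumSquares {v : Poly n} (hv : v ∈ E) : v * v ∈ sumSquares E :=
  AddSubmonoid.subset_closure ⟨v, hv, (sq v).symm⟩

theorem mul_mem_quadModule_of_mem_nonnegs {q v : Poly n} (hq : q ∈ insert 1 G.nonnegs) (hv : v ∈ E)
    (hqv : q * (v * v) ∈ E * E) : q * (v * v) ∈ quadModule E G :=
  ⟨∅, {q}, fun _ => 0, fun _ => v * v, by simp, by simpa using hq, by simp,
    by simpa using ⟨mul_self_mem_sumSquares hv, hqv⟩, by simp⟩

theorem mul_mem_quadModule_of_mem_eqs {q v : Poly n} (hq : q ∈ G.eqs) (hv : v ∈ E)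
    (hqv : q * v ∈ E * E) : q * v ∈ quadModule E G :=
  ⟨{q}, ∅, fun _ => v, fun _ => 0, by simpa using hq, by simp, by simpa using ⟨hv, hqv⟩,
    by simp, by simp⟩

theorem formAt_mul_self_nonneg {Λ : Module.Dual ℝ ↥(E * E)} (hΛ : Λ ∈ dualCone E G)
    {v : Poly n} (hv : v ∈ E) : 0 ≤ formAt Λ (v * v) := by
  have := hΛ.1 _ (mul_mem_quadModule_of_mem_nonnegs (q := 1) (G := G) (Set.mem_insert _ _) hv
    (by simpa using Submodule.mul_mem_mul hv hv))
  simpa using this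

/-- Multipliers of equations carry no sign condition, so $v$ and $-v$ give opposite inequalities. -/
theorem formAt_mul_eq_zero_of_mem_eqs {Λ : Module.Dual ℝ ↥(E * E)} (hΛ : Λ ∈ dualCone E G)
    {q v : Poly n} (hq : q ∈ G.eqs) (hv : v ∈ E) (hqv : q * v ∈ E * E) :
    formAt Λ (q * v) = 0 := by
  obtain ⟨L, hL⟩ := exists_extend_formAt Λ
  have hneg : q * -v ∈ E * E := by simpa using hqv
  have h1 := hΛ.1 _ (mul_mem_quadModule_of_mem_eqs hq hv hqv)
  have h2 := hΛ.1 _ (mul_mem_quadModule_of_mem_eqs hq (neg_mem hv) hneg)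
  rw [hL _ hqv] at h1 ⊢
  rw [hL _ hneg, mul_neg, map_neg] at h2
  linarith

/-- Cauchy–Schwarz: isotropic vectors of a positive semidefinite form are in its kernel. -/
theorem apply_mul_eq_zero_of_isotropic {L : Poly n →ₗ[ℝ] ℝ} (hL : ∀ p ∈ E, 0 ≤ L (p * p))
    {p q : Poly n} (hp : p ∈ E) (hq : q ∈ E) (hpp : L (p * p) = 0) : L (p * q) = 0 := by
  by_contra hne
  -- The multiple of $p$ is chosen so that the square would have $L$-value exactly $-1$.
  have h := hL (q + (-(L (q * q) + 1) / (2 * L (p * q))) • p) (add_mem hq (E.smul_mem _ hp))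
  set t := -(L (q * q) + 1) / (2 * L (p * q)) with ht
  have hexp : (q + t • p) * (q + t • p) = q * q + (2 * t) • (p * q) + (t * t) • (p * p) := by
    simp only [smul_eq_C_mul, map_mul, map_ofNat]; ring
  have ht2 : 2 * t * L (p * q) = -(L (q * q) + 1) := by rw [ht]; field_simp
  rw [hexp] at h
  simp only [map_add, map_smul, smul_eq_mul, hpp, ht2] at h
  linarith

theorem mem_ker_hankel_iff (Λ : Module.Dual ℝ ↥(E * E)) (p : E) :
    p ∈ LinearMap.ker (hankel E Λ) ↔ ∀ q ∈ E, formAt Λ (p * q) = 0 := by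
  rw [LinearMap.mem_ker]
  constructor
  · intro h q hq
    rw [formAt_of_mem _ (Submodule.mul_mem_mul p.2 hq)]
    exact LinearMap.congr_fun h ⟨q, hq⟩
  · intro h
    ext q
    refine Eq.trans ?_ (h q q.2)
    rw [formAt_of_mem _ (Submodule.mul_mem_mul p.2 q.2)]
    rfl

/-- The kernel of the Hankel operator of an optimal form vanishes at the feasible points whose
evaluation attains the relaxed infimum. -/
theorem IsOptimalForm.eval_eq_zero [FiniteDimensional ℝ E] {f : Poly n}
    {Λ : Module.Dual ℝ ↥(E * E)} (hΛ : IsOptimalForm f E G Λ) (h1 : (1 : Poly n) ∈ E)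
    (hf : f ∈ E * E) {x : Fin n → ℝ} (hx : x ∈ G.feasible) (hfx : eval x f = formAt Λ f)
    {p : Poly n} (hp : p ∈ E) (hpp : formAt Λ (p * p) = 0) : eval x p = 0 := by
  obtain ⟨hmem, hopt, hmax⟩ := hΛ
  -- The average still attains the relaxed infimum, and its kernel is contained in that of `Λ`.
  -- Maximal rank of `Λ` forces equality, so isotropic vectors of `Λ` are isotropic for the average
  -- and vanish at $x$.
  set Λ' := (1 / 2 : ℝ) • (Λ + evalForm E x) with hΛ'
  have hmem' : Λ' ∈ dualCone E G := midpoint_mem_dualCone hmem (evalForm_mem_dualCone h1 hx)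
  have hval : ∀ q ∈ E * E, formAt Λ' q = (1 / 2) * (formAt Λ q + eval x q) := fun q hq => by
    rw [hΛ', formAt_smul_form, formAt_add_form, formAt_evalForm x hq]
  have hrank := hmax Λ' hmem' (by
    rw [hval f hf, hfx, ← hopt]; congr 1; ring)
  have hker : ∀ {q : Poly n}, q ∈ E → formAt Λ (q * q) = 0 → ∀ s ∈ E, formAt Λ (q * s) = 0 := by
    obtain ⟨L, hL⟩ := exists_extend_formAt Λ
    intro q hq hqq s hs
    rw [hL _ (Submodule.mul_mem_mul hq hq)] at hqq
    rw [hL _ (Submodule.mul_mem_mul hq hs)]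
    refine apply_mul_eq_zero_of_isotropic (fun p hp => ?_) hq hs hqq
    rw [← hL _ (Submodule.mul_mem_mul hp hp)]
    exact formAt_mul_self_nonneg hmem hp
  have hiso : ∀ q ∈ E, formAt Λ' (q * q) = 0 → formAt Λ (q * q) = 0 ∧ eval x q = 0 := by
    intro q hq h
    rw [hval _ (Submodule.mul_mem_mul hq hq), map_mul] at h
    have h₁ := formAt_mul_self_nonneg hmem hq
    have h₂ := mul_self_nonneg (eval x q)
    exact ⟨by linarith, mul_self_eq_zero.mp (by linarith)⟩
  have hle : LinearMap.ker (hankel E Λ') ≤ LinearMap.ker (hankel E Λ) := fun q hq => by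
    rw [mem_ker_hankel_iff] at hq ⊢
    exact hker q.2 (hiso q q.2 (hq q q.2)).1
  have heq : LinearMap.ker (hankel E Λ') = LinearMap.ker (hankel E Λ) := by
    refine Submodule.eq_of_le_of_finrank_le hle ?_
    have e₁ := (hankel E Λ).finrank_range_add_finrank_ker
    have e₂ := (hankel E Λ').finrank_range_add_finrank_ker
    unfold hankelRank at hrank
    omega
  have hpk : (⟨p, hp⟩ : E) ∈ LinearMap.ker (hankel E Λ') := by
    rw [heq, mem_ker_hankel_iff]
    exact hker hp hpp
  rw [mem_ker_hankel_iff] at hpk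
  exact (hiso p hp (hpk p hp)).2

/-- Under a flat extension the form is determined by the coordinates with respect to an
orthonormal family of the smaller space. -/
theorem IsFlatExtension.apply_mul {r : ℕ} {V W : Submodule ℝ (Poly n)} [FiniteDimensional ℝ W]
    {h : V ≤ W} {Λ : Module.Dual ℝ ↥(W * W)} (hflat : IsFlatExtension h Λ)
    (hr : Module.finrank ℝ V ≤ r) {L : Poly n →ₗ[ℝ] ℝ} (hL : ∀ p ∈ W * W, formAt Λ p = L p)
    {β : Fin r → Poly n} (hβV : ∀ i, β i ∈ V)
    (hβ : ∀ i j, L (β i * β j) = if i = j then 1 else 0) {p q : Poly n} (hp : p ∈ W)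
    (hq : q ∈ W) : L (p * q) = ∑ i, L (p * β i) * L (q * β i) := by
  have hH : ∀ s t : W, hankel W Λ s t = L (s * t) := fun s t => by
    rw [← hL _ (Submodule.mul_mem_mul s.2 t.2), formAt_of_mem _ (Submodule.mul_mem_mul s.2 t.2)]
    rfl
  let γ : Fin r → W := fun i => ⟨β i, h (hβV i)⟩
  have hcoef : ∀ (a : Fin r → ℝ) (t : W),
      (∑ i, a i • hankel W Λ (γ i)) t = ∑ i, a i * L (β i * t) := fun a t => by
    simp [LinearMap.sum_apply, hH, γ]
  have hli : LinearIndependent ℝ fun i => hankel W Λ (γ i) := by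
    rw [Fintype.linearIndependent_iff]
    intro a ha j
    have := hcoef a (γ j)
    rw [ha] at this
    simpa [γ, hβ] using this.symm
  -- Here flatness enters: the range contains $r$ independent images, and its dimension is the rank
  -- on $V$, hence at most $\dim V\le r$.
  have hspan : Submodule.span ℝ (Set.range fun i => hankel W Λ (γ i)) =
      LinearMap.range (hankel W Λ) := by
    refine Submodule.eq_of_le_of_finrank_le ?_ ?_
    · rw [Submodule.span_le]
      rintro _ ⟨i, rfl⟩
      exact ⟨γ i, rfl⟩
    · rw [finrank_span_eq_card hli, Fintype.card_fin]
      have : FiniteDimensional ℝ V := Submodule.finiteDimensional_of_le h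
      exact (hflat.le.trans (LinearMap.finrank_range_le _)).trans hr
  have hmem : hankel W Λ ⟨p, hp⟩ ∈ Submodule.span ℝ (Set.range fun i => hankel W Λ (γ i)) :=
    hspan ▸ ⟨_, rfl⟩
  obtain ⟨a, ha⟩ := (Submodule.mem_span_range_iff_exists_fun ℝ).mp hmem
  have hval : ∀ t : W, L (p * t) = ∑ i, a i * L (β i * t) := fun t => by
    rw [← hcoef, ha, hH]
  have haj : ∀ j, L (p * β j) = a j := fun j => by
    rw [hval (γ j)]
    simp [γ, hβ]
  rw [hval ⟨q, hq⟩]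
  exact Finset.sum_congr rfl fun i _ => by rw [haj, mul_comm q]

end Forms

/-! ### Orthogonality in the Decomposition algorithm -/

section Decomposition

variable {n : ℕ} {E : Submodule ℝ (Poly n)}

/-- Repetitions in the list do no harm: a repeated member is orthogonal to itself, so both sides
vanish. -/
theorem sum_map_mul_of_pairwise {L : Poly n →ₗ[ℝ] ℝ} (a : Poly n → ℝ) {B : List (Poly n)}
    (hB : B.Pairwise fun b c => L (b * c) = 0) {c : Poly n} (hc : c ∈ B) :
    (B.map fun d => a d * L (d * c)).sum = a c * L (c * c) := by
  induction B with
  | nil => simp at hc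
  | cons d B ih =>
    rw [List.pairwise_cons] at hB
    rw [List.map_cons, List.sum_cons]
    rcases List.mem_cons.mp hc with rfl | hc
    · have : (B.map fun d => a d * L (d * c)).sum = 0 := by
        refine List.sum_eq_zero fun y hy => ?_
        obtain ⟨d, hd, rfl⟩ := List.mem_map.mp hy
        rw [mul_comm d, hB.1 d hd, mul_zero]
      rw [this, add_zero]
    · rw [ih hB.2 hc, hB.1 c hc, mul_zero, zero_add]

/-- The lists built by the Decomposition algorithm contain `1` and are orthogonal families of
non-isotropic vectors. -/
theorem DecompState.orthogonal {Λ : Module.Dual ℝ ↥(E * E)} (h1 : formAt Λ 1 = 1)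
    {B : List (Poly n)} {s : ℕ} (h : DecompState E Λ B s) :
    1 ∈ B ∧ (∀ b ∈ B, formAt Λ (b * b) ≠ 0) ∧
      B.Pairwise (fun b c => formAt Λ (b * c) = 0) := by
  induction h with
  | init => simp [h1]
  | @step B s B' _ _ hE hmax ih =>
    obtain ⟨hB1, hBne, hBo⟩ := ih
    refine ⟨List.mem_append_left _ hB1, fun b hb => ?_, ?_⟩
    · rcases List.mem_append.mp hb with hb | hb
      · exact hBne b hb
      · exact (hmax.1 b hb).2
    obtain ⟨L, hL⟩ := exists_extend_formAt Λ
    -- The loop guard $\langle B\rangle^+\subset E$ puts the products below in $\langle E\cdot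
    -- E\rangle$, where `formAt` is the form and not its default value.
    have hBE : ∀ b ∈ B, b ∈ E := fun b hb => hE (le_prolong _ (Submodule.subset_span hb))
    have hXE : ∀ b ∈ B, ∀ k, X k * b ∈ E := fun b hb k =>
      hE (mul_X_mem_prolong (Submodule.subset_span hb) k)
    have hBo' : B.Pairwise (fun b c => L (b * c) = 0) := hBo.imp_of_mem fun hb hc h => by
      rw [← hL _ (Submodule.mul_mem_mul (hBE _ hb) (hBE _ hc)), h]
    have hres : ∀ c ∈ B, ∀ b ∈ B, ∀ k,
        decompResidual Λ B b k ∈ E ∧ L (decompResidual Λ B b k * c) = 0 := by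
      intro c hc b hb k
      refine ⟨sub_mem (hXE b hb k) (list_sum_mem fun y hy => ?_), ?_⟩
      · obtain ⟨d, hd, rfl⟩ := List.mem_map.mp hy
        exact E.smul_mem _ (hBE d hd)
      · rw [decompResidual, sub_mul, map_sub, ← List.sum_map_mul_right, map_list_sum,
          List.map_map]
        have : (L ∘ fun d => (formAt Λ (X k * b * d) / formAt Λ (d * d)) • d * c) =
            fun d => (formAt Λ (X k * b * d) / formAt Λ (d * d)) * L (d * c) := by
          ext d; simp
        have hcc := hL _ (Submodule.mul_mem_mul (hBE c hc) (hBE c hc))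
        rw [this, sum_map_mul_of_pairwise (fun d => formAt Λ (X k * b * d) / formAt Λ (d * d))
          hBo' hc, ← hcc, div_mul_cancel₀ _ (hBne c hc),
          hL _ (Submodule.mul_mem_mul (hXE b hb k) (hBE c hc)), sub_self]
    have hspan : ∀ c ∈ B, ∀ p ∈ residualSpan Λ B, p ∈ E ∧ L (p * c) = 0 := by
      intro c hc p hp
      induction hp using Submodule.span_induction with
      | mem p hp => obtain ⟨b, hb, k, rfl⟩ := hp; exact hres c hc b hb k
      | zero => simp
      | add p q _ _ hp hq => exact ⟨add_mem hp.1 hq.1, by simp [add_mul, hp.2, hq.2]⟩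
      | smul a p _ hp => exact ⟨E.smul_mem _ hp.1, by simp [hp.2]⟩
    refine List.pairwise_append.mpr ⟨hBo, hmax.2.1, fun c hc b hb => ?_⟩
    obtain ⟨hbE, hb0⟩ := hspan c hc b (hmax.1 b hb).1
    rw [mul_comm c b, hL _ (Submodule.mul_mem_mul hbE (hBE c hc)), hb0]

end Decomposition

/-! ### Quadrature and interpolation from an orthogonal family -/

theorem prolong_mono {n : ℕ} {V W : Submodule ℝ (Poly n)} (h : V ≤ W) : prolong V ≤ prolong W :=
  sup_le_sup h (iSup_mono fun _ => Submodule.map_mono h)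

/-- A form that is flat over the span of an orthogonal family `b` with `⟨b⟩⁺ ⊆ W` is on
`⟨W · W⟩` a positive combination of evaluations at as many points as `b` has members. -/
theorem IsFlatExtension.exists_quadrature {n r : ℕ} {W : Submodule ℝ (Poly n)}
    [FiniteDimensional ℝ W] (hW : ConnectedToOne W) {b : Fin r → Poly n}
    (hBW : prolong (Submodule.span ℝ (Set.range b)) ≤ W) {Λ : Module.Dual ℝ ↥(W * W)}
    (hflat : IsFlatExtension ((le_prolong _).trans hBW) Λ)
    {L : Poly n →ₗ[ℝ] ℝ} (hL : ∀ p ∈ W * W, formAt Λ p = L p) (hpos : ∀ i, 0 < L (b i * b i))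
    (horth : ∀ i j, i ≠ j → L (b i * b j) = 0) :
    ∃ (ξ : Fin r → Fin n → ℝ) (w : Fin r → ℝ), Function.Injective ξ ∧ (∀ i, 0 < w i) ∧
      ∀ p ∈ W * W, L p = ∑ i, w i * eval (ξ i) p := by
  let β : Fin r → Poly n := fun i => (√(L (b i * b i)))⁻¹ • b i
  have hβB : ∀ i, β i ∈ Submodule.span ℝ (Set.range b) := fun i =>
    Submodule.smul_mem _ _ (Submodule.subset_span ⟨i, rfl⟩)
  have hβ : ∀ i j, L (β i * β j) = if i = j then 1 else 0 := fun i j => by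
    simp only [β, smul_mul_smul_comm, map_smul, smul_eq_mul]
    split_ifs with hij
    · subst hij
      rw [← mul_inv, Real.mul_self_sqrt (hpos i).le, inv_mul_cancel₀ (hpos i).ne']
    · rw [horth i j hij, mul_zero]
  have hr : Module.finrank ℝ (Submodule.span ℝ (Set.range b)) ≤ r := by
    simpa [Set.finrank] using finrank_range_le_card (R := ℝ) b
  refine PolyOpt.exists_quadrature L W hW β ?_ hβ fun p hp q hq =>
    hflat.apply_mul hr hL hβB hβ hp hq
  refine (prolong_mono (Submodule.span_le.mpr ?_)).trans hBW
  rintro _ ⟨i, rfl⟩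
  exact hβB i

/-- Interpolation at the nodes of a quadrature formula for a form with orthogonal family `b`. -/
theorem exists_sum_smul_eval_eq {n r : ℕ} {W : Submodule ℝ (Poly n)} {b : Fin r → Poly n}
    (hbW : ∀ i, b i ∈ W) {L : Poly n →ₗ[ℝ] ℝ} (hne : ∀ i, L (b i * b i) ≠ 0)
    (horth : ∀ i j, i ≠ j → L (b i * b j) = 0) {ξ : Fin r → Fin n → ℝ} {w : Fin r → ℝ}
    (hq : ∀ p ∈ W * W, L p = ∑ i, w i * eval (ξ i) p) (y : Fin r → ℝ) :
    ∃ a : Fin r → ℝ, (∀ l, eval (ξ l) (∑ i, a i • b i) = y l) ∧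
      ∀ i, a i = (∑ l, w l * (y l * eval (ξ l) (b i))) / L (b i * b i) := by
  have hcoef : ∀ (a y : Fin r → ℝ), (∀ l, eval (ξ l) (∑ i, a i • b i) = y l) →
      ∀ i, a i = (∑ l, w l * (y l * eval (ξ l) (b i))) / L (b i * b i) := by
    intro a y hy j
    rw [eq_div_iff (hne j)]
    have h1 : L ((∑ i, a i • b i) * b j) = a j * L (b j * b j) := by
      rw [Finset.sum_mul, map_sum, Finset.sum_eq_single j]
      · simp
      · intro i _ hij
        simp [horth i j hij]
      · simp
    rw [← h1, hq _ (Submodule.mul_mem_mul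
      (sum_mem fun i _ => W.smul_mem _ (hbW i)) (hbW j))]
    simp only [map_mul, hy]
  -- There are as many nodes as members of `b`, so it suffices that zero data force zero
  -- coefficients.
  let ev : (Fin r → ℝ) →ₗ[ℝ] (Fin r → ℝ) :=
    (LinearMap.pi fun l => (aeval (ξ l)).toLinearMap).comp (Fintype.linearCombination ℝ b)
  have hev : ∀ a l, ev a l = eval (ξ l) (∑ i, a i • b i) := fun a l => by
    simp [ev, Fintype.linearCombination_apply, smul_eval]
  have hinj : Function.Injective ev := by
    rw [← LinearMap.ker_eq_bot, LinearMap.ker_eq_bot']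
    intro a ha
    ext i
    rw [hcoef a 0 (fun l => by rw [← hev, ha]) i]
    simp
  obtain ⟨a, ha⟩ := LinearMap.injective_iff_surjective.mp hinj y
  have ha' : ∀ l, eval (ξ l) (∑ i, a i • b i) = y l := fun l => by rw [← hev, ha]
  exact ⟨a, ha', hcoef a y ha'⟩

end PolyOpt

end

/-! ### The proposition -/

theorem proposition5p1 {n : ℕ}
    -- the minimization problem: minimize `f` on the non-empty set `S = 𝒮(g)`
    (f : PolyOpt.Poly n) (g : PolyOpt.Constraints n)
    (hg₀ : g.eqs.Finite) (hg₁ : g.nonnegs.Finite) (hS : g.feasible.Nonempty)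
    (hbdd : BddBelow ((fun x => MvPolynomial.eval x f) '' g.feasible))
    -- the constraints `G` of the relaxation: `V_min ⊆ 𝒮(G) ⊆ S` and the same infimum
    (G : PolyOpt.Constraints n) (hGS : G.feasible ⊆ g.feasible)
    (hVG : PolyOpt.minimizers f g.feasible ⊆ G.feasible)
    (hinf : PolyOpt.infValue f G.feasible = PolyOpt.infValue f g.feasible)
    -- the linear form `Λ`, optimal for `f`, and the output `b` of a successful decomposition
    (E : Submodule ℝ (PolyOpt.Poly n)) (hEfin : FiniteDimensional ℝ E)
    (hE : PolyOpt.ConnectedToOne E)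
    (Λ : Module.Dual ℝ ↥(E * E)) (hΛ : PolyOpt.IsOptimalForm f E G Λ)
    {r : ℕ} (b : Fin r → PolyOpt.Poly n)
    (hb : PolyOpt.DecompositionSucceeds E Λ (List.ofFn b))
    -- the flat extension property holds on some `W` with `⟨B⟩⁺ ⊆ W ⊆ E` that is large enough
    -- for `f` and the constraints
    (W : Submodule ℝ (PolyOpt.Poly n)) (hWE : W ≤ E) (hW : PolyOpt.ConnectedToOne W)
    (hBW : PolyOpt.prolong (Submodule.span ℝ (Set.range b)) ≤ W)
    (hflat : PolyOpt.IsFlatExtension ((PolyOpt.le_prolong _).trans hBW)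
      (PolyOpt.restrictForm hWE Λ))
    (hfW : f ∈ W * W)
    (hG₀ : ∀ q ∈ G.eqs, ∀ v ∈ Submodule.span ℝ (Set.range b), q * v ∈ W * W)
    (hG₁ : ∀ q ∈ G.nonnegs, ∀ v ∈ Submodule.span ℝ (Set.range b),
      ∀ w ∈ Submodule.span ℝ (Set.range b), q * (v * w) ∈ W * W) :
    (∀ i, PolyOpt.formAt Λ (b i * b i) ≠ 0) ∧
    ∃ β : Module.Basis (Fin r) ℝ (PolyOpt.MinAlgebra f g.feasible),
      (∀ i, β i = Ideal.Quotient.mk (PolyOpt.minIdeal f g.feasible) (b i)) ∧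
      (∀ k : Fin n, LinearMap.toMatrix β β (PolyOpt.mulOp f g.feasible k) =
        Matrix.of fun i j =>
          PolyOpt.formAt Λ (MvPolynomial.X k * b i * b j) / PolyOpt.formAt Λ (b i * b i)) ∧
      ∃ (ξ : Fin r → Fin n → ℝ) (u : Fin r → PolyOpt.MinAlgebra f g.feasible),
        Function.Injective ξ ∧ Set.range ξ = PolyOpt.minimizers f g.feasible ∧
        LinearIndependent ℝ u ∧
        ∀ i k, PolyOpt.mulOp f g.feasible k (u i) = ξ i k • u i := by
  have : FiniteDimensional ℝ W := Submodule.finiteDimensional_of_le hWE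
  have hcone := hΛ.1
  have hWWE : W * W ≤ E * E := mul_le_mul' hWE hWE
  obtain ⟨-, hne, horthL⟩ := hb.1.orthogonal hcone.2
  replace hne : ∀ i, PolyOpt.formAt Λ (b i * b i) ≠ 0 := fun i =>
    hne _ (List.mem_ofFn.mpr ⟨i, rfl⟩)
  rw [List.pairwise_ofFn] at horthL
  obtain ⟨L, hL⟩ := PolyOpt.exists_extend_formAt Λ
  have hbB : ∀ i, b i ∈ Submodule.span ℝ (Set.range b) := fun i => Submodule.subset_span ⟨i, rfl⟩
  have hSW : Submodule.span ℝ (Set.range b) ≤ W := (PolyOpt.le_prolong _).trans hBW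
  have hbW : ∀ i, b i ∈ W := fun i => hSW (hbB i)
  have hbb : ∀ i j, PolyOpt.formAt Λ (b i * b j) = L (b i * b j) := fun i j =>
    hL _ (hWWE (Submodule.mul_mem_mul (hbW i) (hbW j)))
  have hneL : ∀ i, L (b i * b i) ≠ 0 := fun i => hbb i i ▸ hne i
  have horth : ∀ i j, i ≠ j → L (b i * b j) = 0 := fun i j hij => by
    rcases lt_or_gt_of_ne hij with h | h
    · rw [← hbb, horthL h]
    · rw [mul_comm (b i), ← hbb, horthL h]
  have hpos : ∀ i, 0 < L (b i * b i) := fun i =>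
    lt_of_le_of_ne (hbb i i ▸ PolyOpt.formAt_mul_self_nonneg hcone (hWE (hbW i))) (hneL i).symm
  have hLW : ∀ p ∈ W * W, PolyOpt.formAt (PolyOpt.restrictForm hWE Λ) p = L p := fun p hp => by
    rw [← hL p (hWWE hp), PolyOpt.formAt_of_mem _ hp, PolyOpt.formAt_of_mem _ (hWWE hp)]
    rfl
  obtain ⟨ξ, w, hξ, hw, hquad⟩ := hflat.exists_quadrature hW hBW hLW hpos horth
  have hinterp := PolyOpt.exists_sum_smul_eval_eq hbW hneL horth hquad
  -- Lagrange interpolants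
  have hlag : ∀ i : Fin r, ∃ v ∈ Submodule.span ℝ (Set.range b),
      ∀ l, MvPolynomial.eval (ξ l) v = if l = i then 1 else 0 := fun i => by
    obtain ⟨a, ha, -⟩ := hinterp fun l => if l = i then 1 else 0
    exact ⟨_, sum_mem fun j _ => Submodule.smul_mem _ _ (hbB j), ha⟩
  choose ℓ hℓB hℓ using hlag
  have hℓW : ∀ i, ℓ i ∈ W := fun i => hSW (hℓB i)
  have hone : (1 : PolyOpt.Poly n) ∈ W := hW.one_mem
  -- the nodes are feasible
  have hfeas : ∀ i, ξ i ∈ G.feasible := fun i => by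
    refine ⟨fun q hq => ?_, fun q hq => ?_⟩
    -- Testing on $q\ell_i$, and on $q\ell_i^2$ for inequalities, isolates one node: both have
    -- `Λ`-value $w_i\,q(\xi_i)$.
    · have hm := hG₀ q hq _ (hℓB i)
      have h0 := PolyOpt.formAt_mul_eq_zero_of_mem_eqs hcone hq (hWE (hℓW i)) (hWWE hm)
      rw [hL _ (hWWE hm), hquad _ hm] at h0
      simpa [hℓ, (hw i).ne'] using h0
    · have hm := hG₁ q hq _ (hℓB i) _ (hℓB i)
      have h0 := hcone.1 _ (PolyOpt.mul_mem_quadModule_of_mem_nonnegs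
        (Set.mem_insert_of_mem _ hq) (hWE (hℓW i)) (hWWE hm))
      rw [hL _ (hWWE hm), hquad _ hm] at h0
      simp only [map_mul, hℓ, mul_ite, mul_one, mul_zero, Finset.sum_ite_eq', Finset.mem_univ,
        if_true] at h0
      exact nonneg_of_mul_nonneg_right h0 (hw i)
  -- the nodes are minimizers
  have hwsum : ∑ i, w i = 1 := by
    have h11 : (1 : PolyOpt.Poly n) ∈ W * W := by simpa using Submodule.mul_mem_mul hone hone
    have h := hquad 1 h11
    rw [← hL _ (hWWE h11), hcone.2] at h
    simpa using h.symm
  have hr : Nonempty (Fin r) := by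
    by_contra hemp
    rw [not_nonempty_iff] at hemp
    simp at hwsum
  have hΛf : PolyOpt.formAt Λ f = ∑ i, w i * MvPolynomial.eval (ξ i) f := by
    rw [hL _ (hWWE hfW), hquad _ hfW]
  have hΛle : ∀ x ∈ G.feasible, PolyOpt.formAt Λ f ≤ MvPolynomial.eval x f := fun x hx => by
    have h := iInf₂_le (f := fun Λ' (_ : Λ' ∈ PolyOpt.dualCone E G) =>
      ((PolyOpt.formAt Λ' f : ℝ) : EReal)) _ (PolyOpt.evalForm_mem_dualCone (hWE hone) hx)
    rw [PolyOpt.formAt_evalForm x (hWWE hfW)] at h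
    exact EReal.coe_le_coe_iff.mp (hΛ.2.1.trans_le h)
  have hmin_le : ∀ x ∈ g.feasible, PolyOpt.infValue f g.feasible ≤ MvPolynomial.eval x f :=
    fun x hx => csInf_le hbdd ⟨x, hx, rfl⟩
  have hΛinf : PolyOpt.formAt Λ f ≤ PolyOpt.infValue f g.feasible := by
    rw [← hinf]
    refine le_csInf ⟨_, ξ hr.some, hfeas _, rfl⟩ ?_
    rintro _ ⟨x, hx, rfl⟩
    exact hΛle x hx
  -- The weighted mean of the values $f(\xi_i)\ge f^*$ is at most $f^*$, with positive weights.
  have hξf : ∀ i, MvPolynomial.eval (ξ i) f = PolyOpt.infValue f g.feasible := by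
    have hnn : ∀ i ∈ Finset.univ, 0 ≤
        w i * (MvPolynomial.eval (ξ i) f - PolyOpt.infValue f g.feasible) := fun i _ =>
      mul_nonneg (hw i).le (sub_nonneg.mpr (hmin_le _ (hGS (hfeas i))))
    have hsum : ∑ i, w i * (MvPolynomial.eval (ξ i) f - PolyOpt.infValue f g.feasible) = 0 := by
      refine le_antisymm ?_ (Finset.sum_nonneg hnn)
      simp only [mul_sub, Finset.sum_sub_distrib, ← Finset.sum_mul, hwsum, ← hΛf]
      linarith
    intro i
    have := (Finset.sum_eq_zero_iff_of_nonneg hnn).mp hsum i (Finset.mem_univ i)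
    exact sub_eq_zero.mp ((mul_eq_zero.mp this).resolve_left (hw i).ne')
  have hΛval : PolyOpt.formAt Λ f = PolyOpt.infValue f g.feasible := by
    rw [hΛf]
    simp only [hξf, ← Finset.sum_mul, hwsum, one_mul]
  -- every minimizer is a node
  have hvan : ∀ p ∈ W, (∀ i, MvPolynomial.eval (ξ i) p = 0) →
      ∀ x ∈ PolyOpt.minimizers f g.feasible, MvPolynomial.eval x p = 0 := by
    intro p hp hpξ x hx
    have hpp := Submodule.mul_mem_mul hp hp
    refine hΛ.eval_eq_zero (hWE hone) (hWWE hfW) (hVG hx) (hx.2.trans hΛval.symm) (hWE hp) ?_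
    rw [hL _ (hWWE hpp), hquad _ hpp]
    simp [hpξ]
  have hrange : Set.range ξ = PolyOpt.minimizers f g.feasible := by
    refine Set.Subset.antisymm ?_ fun x hx => ?_
    · rintro _ ⟨i, rfl⟩
      exact ⟨hGS (hfeas i), hξf i⟩
    -- The polynomials $1-\sum_i\ell_i$ and $(x_k-\xi_{i,k})\ell_i$ lie in $W$ and vanish at the
    -- nodes, hence at $x$. The first yields some $\ell_i(x)\ne0$, the second then $x_k=\xi_{i,k}$.
    · have h1 := hvan (1 - ∑ i, ℓ i) (sub_mem hone (sum_mem fun i _ => hℓW i))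
        (fun l => by simp [hℓ]) x hx
      obtain ⟨i, hi⟩ : ∃ i, MvPolynomial.eval x (ℓ i) ≠ 0 := by
        by_contra! hcon
        simp [hcon] at h1
      refine ⟨i, funext fun k => ?_⟩
      have h2 := hvan (MvPolynomial.X k * ℓ i - ξ i k • ℓ i)
        (sub_mem (hBW (PolyOpt.mul_X_mem_prolong (hℓB i) k)) (W.smul_mem _ (hℓW i)))
        (fun l => by
          by_cases hl : l = i
          · subst hl; simp [MvPolynomial.smul_eval]
          · simp [hℓ, hl, MvPolynomial.smul_eval]) x hx
      rw [map_sub, map_mul, MvPolynomial.eval_X, MvPolynomial.smul_eval, ← sub_mul] at h2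
      exact (sub_eq_zero.mp ((mul_eq_zero.mp h2).resolve_right hi)).symm
  -- the quotient algebra
  have hI : ∀ p, p ∈ PolyOpt.minIdeal f g.feasible ↔ ∀ l, MvPolynomial.eval (ξ l) p = 0 :=
    fun p => by
      rw [PolyOpt.minIdeal, ← hrange, MvPolynomial.mem_vanishingIdeal_iff, Set.forall_mem_range]
      simp
  let π := Ideal.Quotient.mkₐ ℝ (PolyOpt.minIdeal f g.feasible)
  have hπ : ∀ p q, π p = π q ↔ ∀ l, MvPolynomial.eval (ξ l) p = MvPolynomial.eval (ξ l) q :=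
    fun p q => by
      refine (Ideal.Quotient.eq (I := PolyOpt.minIdeal f g.feasible)).trans ((hI _).trans ?_)
      simp only [map_sub, sub_eq_zero]
  have hπX : ∀ k p, PolyOpt.mulOp f g.feasible k (π p) = π (MvPolynomial.X k * p) := fun k p => by
    rw [map_mul]; rfl
  have hrep : ∀ p, ∃ a : Fin r → ℝ, π p = ∑ i, a i • π (b i) ∧
      ∀ i, a i = (∑ l, w l * (MvPolynomial.eval (ξ l) p * MvPolynomial.eval (ξ l) (b i))) /
        L (b i * b i) := fun p => by
    obtain ⟨a, ha, ha'⟩ := hinterp fun l => MvPolynomial.eval (ξ l) p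
    refine ⟨a, ?_, ha'⟩
    simp only [← map_smul, ← map_sum]
    exact (hπ _ _).mpr fun l => (ha l).symm
  have hli : LinearIndependent ℝ fun i => π (ℓ i) := by
    rw [Fintype.linearIndependent_iff]
    intro a ha j
    simp only [← map_smul, ← map_sum] at ha
    have := (hπ _ 0).mp (ha.trans (map_zero π).symm) j
    simpa [hℓ, MvPolynomial.smul_eval] using this
  have hspan : ⊤ ≤ Submodule.span ℝ (Set.range fun i => π (b i)) := by
    intro x _
    obtain ⟨p, rfl⟩ := Ideal.Quotient.mk_surjective x
    obtain ⟨a, ha, -⟩ := hrep p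
    change π p ∈ _
    rw [ha]
    exact sum_mem fun i _ => Submodule.smul_mem _ _ (Submodule.subset_span ⟨i, rfl⟩)
  -- The independent interpolants bound the dimension below, the spanning `b` bounds it above.
  have hfr : Fintype.card (Fin r) = Module.finrank ℝ (PolyOpt.MinAlgebra f g.feasible) := by
    have : Module.Finite ℝ (PolyOpt.MinAlgebra f g.feasible) :=
      ⟨⟨(Set.finite_range fun i => π (b i)).toFinset, by simpa using top_le_iff.mp hspan⟩⟩
    refine le_antisymm hli.fintype_card_le_finrank ?_
    have := finrank_range_le_card (R := ℝ) fun i => π (b i)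
    rwa [Set.finrank, top_le_iff.mp hspan, finrank_top] at this
  let β := basisOfTopLeSpanOfCardEqFinrank (fun i => π (b i)) hspan hfr
  have hβ : ∀ i, β i = π (b i) := fun i => by simp [β]
  refine ⟨hne, β, hβ, fun k => ?_, ξ, fun i => π (ℓ i), hξ, hrange, hli, fun i k => ?_⟩
  · ext i j
    rw [LinearMap.toMatrix_apply, hβ, hπX, Matrix.of_apply]
    -- Column $j$ holds the coordinates of $x_kb_j$. The numerator is symmetric in $i$ and $j$,
    -- which reconciles it with the stated order.
    obtain ⟨a, ha, ha'⟩ := hrep (MvPolynomial.X k * b j)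
    simp only [← hβ] at ha
    have hm := Submodule.mul_mem_mul (hBW (PolyOpt.mul_X_mem_prolong (hbB i) k)) (hbW j)
    rw [ha, β.repr_sum_self, ha', hbb, hL _ (hWWE hm), hquad _ hm]
    congr 1
    refine Finset.sum_congr rfl fun l _ => ?_
    simp only [map_mul]
    ring
  · rw [hπX, ← map_smul]
    refine (hπ _ _).mpr fun l => ?_
    by_cases hl : l = i
    · subst hl; simp [MvPolynomial.smul_eval]
    · simp [hℓ, hl, MvPolynomial.smul_eval]
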